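/- An $\ell$-group is a group with a lattice order that is invariant under left and right multiplication; an $\ell$-homomorphism is a group homomorphism preserving binary joins and meets. An $\ell$-group is representable if it is a subdirect product of totally ordered groups, and Abelian if its group is. A prime subgroup of an $\ell$-group $H$ is a proper, order-convex subgroup and sublattice $\mathfrak p$ of $H$ such that the set of right cosets of $\mathfrak p$ is totally ordered by: $\mathfrak p x\le \mathfrak p y$ if and only if $x\le ty$ for some $t\in\mathfrak p$. The set $\operatorname{Spec} H$ of prime subgroups carries the topology whose open sets are the sets $\{\mathfrak p : A\not\subseteq\mathfrak p\}$, $A\subseteq H$, and $\operatorname{Min} H$ is the subspace of inclusion-minimal prime subgroups. Let $G$ be a partially ordered group (the order is invariant under left and right multiplication), let $\mathsf V$ be the variety of all, of all representable, or of all Abelian $\ell$-groups, and let $\eta\colon G\to F_{\mathsf V}(G)$ be the $\ell$-group free over $G$ in $\mathsf V$: $F_{\mathsf V}(G)\in\mathsf V$, $\eta$ is an order-preserving group homomorphism, and for every order-preserving group homomorphism $p\colon G\to H$ with $H\in\mathsf V$ there is exactly one $\ell$-homomorphism $h\colon F_{\mathsf V}(G)\to H$ with $h\circ\eta=p$. Give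 the subgroup $\eta[G]$ the partial order restricted from $F_{\mathsf V}(G)$. A right order on a partially ordered group $K$ is a submonoid $C\subsetneq K$ with $K=C\cup C^{-1}$, $C\cap C^{-1}=\{\mathrm e\}$ and $\{a\in K : a\ge \mathrm e\}\subseteq C$ (the positive cone of the right-invariant total order $a\le_C b\iff ba^{-1}\in C$, which extends the order of $K$); it is an order if it is closed under conjugation (that is, $\le_C$ is also left invariant). The set of right orders on $K$ has the topology with subbase the sets $\{C: a\in C\}$ and $\{C : a\notin C\}$, $a\in K$, and the set of orders on $K$ has the subspace topology. **Corollary.** If $\mathsf V$ is the variety of all $\ell$-groups, then $\operatorname{Min} F_{\mathsf V}(G)$ is homeomorphic to the space of right orders on $\eta[G]$. If $\mathsf V$ is the variety of representable $\ell$-groups or the variety of Abelian $\ell$-groups, then $\operatorname{Min} F_{\mathsf V}(G)$ is homeomorphic to the space of orders on $\eta[G]$. -/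

import Mathlib

namespace LatticeGroup

universe u

/-! A partially ordered group is a type with `[Group G] [PartialOrder G] [MulLeftMono G]
[MulRightMono G]`; a lattice-ordered group (ℓ-group) is a type with `[Group H] [Lattice H]
[MulLeftMono H] [MulRightMono H]`. Neither is assumed to be commutative. -/

section Classes

/-- A group homomorphism between ℓ-groups is an ℓ-homomorphism if it preserves binary joins and
binary meets. -/
structure IsLHom {H K : Type*} [Group H] [Lattice H] [Group K] [Lattice K] (f : H →* K) :
    Prop where
  map_sup : ∀ a b, f (a ⊔ b) = f a ⊔ f b
  map_inf : ∀ a b, f (a ⊓ b) = f a ⊓ f b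

/-- A class of ℓ-groups. -/
abbrev LClass : Type (u + 1) := ∀ (H : Type u) [Group H] [Lattice H], Prop

/-- The class of all ℓ-groups. -/
def AllLGroups : LClass.{u} := fun _ _ _ => True

/-- The class of Abelian ℓ-groups: the underlying group is commutative. -/
def AbelianLGroups : LClass.{u} := fun H _ _ => ∀ a b : H, a * b = b * a

/-- The class of representable ℓ-groups: subdirect products of totally ordered groups, that is,
there is a point-separating family of surjective ℓ-homomorphisms onto totally ordered groups. -/
def RepresentableLGroups : LClass.{u} := fun H _ _ =>
  ∃ (ι : Type u) (T : ι → Type u) (_ : ∀ i, Group (T i)) (_ : ∀ i, LinearOrder (T i))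
    (_ : ∀ i, MulLeftMono (T i)) (_ : ∀ i, MulRightMono (T i)) (f : ∀ i, H →* T i),
    (∀ i, IsLHom (f i) ∧ Function.Surjective (f i)) ∧
      ∀ a b : H, (∀ i, f i a = f i b) → a = b

end Classes

section Free

/-- Formal ℓ-group terms over a set of generators. -/
inductive Term (G : Type u) : Type u
  | of : G → Term G
  | one : Term G
  | mul : Term G → Term G → Term G
  | inv : Term G → Term G
  | sup : Term G → Term G → Term G
  | inf : Term G → Term G → Term G

/-- Evaluation of a term in an ℓ-group. -/
def Term.eval {G : Type u} {H : Type*} [Group H] [Lattice H] (p : G → H) : Term G → H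
  | .of g => p g
  | .one => 1
  | .mul s t => s.eval p * t.eval p
  | .inv s => (s.eval p)⁻¹
  | .sup s t => s.eval p ⊔ t.eval p
  | .inf s t => s.eval p ⊓ t.eval p

variable (V : LClass.{u}) (G : Type u) [Group G] [PartialOrder G]

/-- Two terms over the partially ordered group `G` are identified if they have the same value under
every positive homomorphism from `G` to an ℓ-group in the class `V`. -/
def termSetoid : Setoid (Term G) where
  r s t := ∀ (H : Type u) [Group H] [Lattice H] [MulLeftMono H] [MulRightMono H], V H →
    ∀ p : G →* H, Monotone p → s.eval p = t.eval p
  iseqv :=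
    { refl := fun _ _ _ _ _ _ _ _ _ => rfl
      symm := fun h H _ _ _ _ hV p hp => (h H hV p hp).symm
      trans := fun h k H _ _ _ _ hV p hp => (h H hV p hp).trans (k H hV p hp) }

/-- The ℓ-group free over the partially ordered group `G` in the class `V`. Its universal property
is proved below. -/
def Free : Type u := Quotient (termSetoid V G)

namespace Free

variable {V G}

/-- The class of a term in the free ℓ-group. -/
def mk (t : Term G) : Free V G := Quotient.mk (termSetoid V G) t

theorem mk_eq {s t : Term G}
    (h : ∀ (H : Type u) [Group H] [Lattice H] [MulLeftMono H] [MulRightMono H], V H →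
      ∀ p : G →* H, Monotone p → s.eval p = t.eval p) : (mk s : Free V G) = mk t :=
  Quotient.sound (s := termSetoid V G) h

theorem ind {P : Free V G → Prop} (h : ∀ t, P (mk t)) (x : Free V G) : P x :=
  Quotient.ind h x

/-- The value of an element of the free ℓ-group under a positive homomorphism. -/
def eval {H : Type u} [Group H] [Lattice H] [MulLeftMono H] [MulRightMono H] (hV : V H)
    (p : G →* H) (hp : Monotone p) : Free V G → H :=
  Quotient.lift (fun t => t.eval p) (fun _ _ h => h H hV p hp)

instance : One (Free V G) := ⟨mk .one⟩

instance : Mul (Free V G) :=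
  ⟨Quotient.map₂ Term.mul fun _ _ h _ _ k H _ _ _ _ hV p hp =>
    congrArg₂ (· * ·) (h H hV p hp) (k H hV p hp)⟩

instance : Inv (Free V G) :=
  ⟨Quotient.map Term.inv fun _ _ h H _ _ _ _ hV p hp => congrArg (·⁻¹) (h H hV p hp)⟩

/-- The join of two elements of the free ℓ-group. -/
def join : Free V G → Free V G → Free V G :=
  Quotient.map₂ Term.sup fun _ _ h _ _ k H _ _ _ _ hV p hp =>
    congrArg₂ (· ⊔ ·) (h H hV p hp) (k H hV p hp)

/-- The meet of two elements of the free ℓ-group. -/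
def meet : Free V G → Free V G → Free V G :=
  Quotient.map₂ Term.inf fun _ _ h _ _ k H _ _ _ _ hV p hp =>
    congrArg₂ (· ⊓ ·) (h H hV p hp) (k H hV p hp)

theorem mk_one : (mk .one : Free V G) = 1 := rfl

theorem mk_mul (s t : Term G) : (mk (.mul s t) : Free V G) = mk s * mk t := rfl

theorem mk_inv (s : Term G) : (mk (.inv s) : Free V G) = (mk s)⁻¹ := rfl

instance : Group (Free V G) :=
  Group.ofLeftAxioms
    (fun a b c => by
      induction a using ind; induction b using ind; induction c using ind
      exact mk_eq fun H _ _ _ _ _ p _ => mul_assoc _ _ _)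
    (fun a => by
      induction a using ind
      exact mk_eq fun H _ _ _ _ _ p _ => one_mul _)
    (fun a => by
      induction a using ind
      exact mk_eq fun H _ _ _ _ _ p _ => inv_mul_cancel _)

/-- The order is the one induced by the lattice operations: `a ≤ b` iff `a ⊔ b = b`. -/
instance : Lattice (Free V G) :=
  letI : Max (Free V G) := ⟨join⟩
  letI : Min (Free V G) := ⟨meet⟩
  Lattice.mk'
    (fun a b => by
      induction a using ind; induction b using ind
      exact mk_eq fun H _ _ _ _ _ p _ => sup_comm _ _)
    (fun a b c => by
      induction a using ind; induction b using ind; induction c using ind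
      exact mk_eq fun H _ _ _ _ _ p _ => sup_assoc _ _ _)
    (fun a b => by
      induction a using ind; induction b using ind
      exact mk_eq fun H _ _ _ _ _ p _ => inf_comm _ _)
    (fun a b c => by
      induction a using ind; induction b using ind; induction c using ind
      exact mk_eq fun H _ _ _ _ _ p _ => inf_assoc _ _ _)
    (fun a b => by
      induction a using ind; induction b using ind
      exact mk_eq fun H _ _ _ _ _ p _ => sup_inf_self)
    (fun a b => by
      induction a using ind; induction b using ind
      exact mk_eq fun H _ _ _ _ _ p _ => inf_sup_self)

theorem mk_sup (s t : Term G) : (mk (.sup s t) : Free V G) = mk s ⊔ mk t := rfl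

theorem mk_inf (s t : Term G) : (mk (.inf s t) : Free V G) = mk s ⊓ mk t := rfl

instance : MulLeftMono (Free V G) :=
  ⟨fun c a b h => by
    rw [← sup_eq_right] at h
    rw [← sup_eq_right]
    have key : c * a ⊔ c * b = c * (a ⊔ b) := by
      induction a using ind; induction b using ind; induction c using ind
      exact mk_eq fun H _ _ _ _ _ p _ => (mul_sup _ _ _).symm
    rw [key, h]⟩

instance : MulRightMono (Free V G) :=
  ⟨fun c a b h => by
    rw [← sup_eq_right] at h
    change a * c ≤ b * c
    rw [← sup_eq_right]
    have key : a * c ⊔ b * c = (a ⊔ b) * c := by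
      induction a using ind; induction b using ind; induction c using ind
      exact mk_eq fun H _ _ _ _ _ p _ => (sup_mul _ _ _).symm
    rw [key, h]⟩

end Free

/-- The universal map from `G` to the ℓ-group free over `G` in the class `V`. -/
def eta : G →* Free V G where
  toFun g := Free.mk (.of g)
  map_one' := Free.mk_eq fun _ _ _ _ _ _ p _ => p.map_one
  map_mul' a b := Free.mk_eq fun _ _ _ _ _ _ p _ => p.map_mul a b

theorem eta_monotone : Monotone (eta V G) := fun a b h => by
  rw [← sup_eq_right]
  exact Free.mk_eq (s := .sup (.of a) (.of b)) (t := .of b)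
    fun H _ _ _ _ _ p hp => sup_eq_right.2 (hp h)

variable {V G}

/-- The ℓ-homomorphism out of the free ℓ-group induced by a positive homomorphism. -/
def Free.lift {H : Type u} [Group H] [Lattice H] [MulLeftMono H] [MulRightMono H] (hV : V H)
    (p : G →* H) (hp : Monotone p) : Free V G →* H where
  toFun := Free.eval hV p hp
  map_one' := rfl
  map_mul' a b := by
    induction a using Free.ind; induction b using Free.ind; rfl

theorem Free.isLHom_lift {H : Type u} [Group H] [Lattice H] [MulLeftMono H] [MulRightMono H]
    (hV : V H) (p : G →* H) (hp : Monotone p) : IsLHom (Free.lift hV p hp) where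
  map_sup a b := by
    induction a using Free.ind; induction b using Free.ind; rfl
  map_inf a b := by
    induction a using Free.ind; induction b using Free.ind; rfl

/-- The universal property of `eta V G : G → Free V G`. -/
theorem Free.existsUnique_lift {H : Type u} [Group H] [Lattice H] [MulLeftMono H]
    [MulRightMono H] (hV : V H) (p : G →* H) (hp : Monotone p) :
    ∃! h : Free V G →* H, IsLHom h ∧ h.comp (eta V G) = p := by
  refine ⟨Free.lift hV p hp, ⟨Free.isLHom_lift hV p hp, MonoidHom.ext fun _ => rfl⟩, ?_⟩
  rintro h ⟨hl, rfl⟩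
  ext x
  induction x using Free.ind with
  | h t =>
    change h (Free.mk t) = t.eval (h.comp (eta V G))
    induction t with
    | of g => rfl
    | one => exact h.map_one
    | mul s t hs ht => rw [Free.mk_mul, map_mul, hs, ht]; rfl
    | inv s hs => rw [Free.mk_inv, map_inv, hs]; rfl
    | sup s t hs ht => rw [Free.mk_sup, hl.map_sup, hs, ht]; rfl
    | inf s t hs ht => rw [Free.mk_inf, hl.map_inf, hs, ht]; rfl

variable (G)

theorem allLGroups_free : AllLGroups (Free AllLGroups G) := trivial

theorem abelianLGroups_free : AbelianLGroups (Free AbelianLGroups G) := fun a b => by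
  induction a using Free.ind; induction b using Free.ind
  exact Free.mk_eq fun H _ _ _ _ hV p _ => hV _ _

theorem representableLGroups_free :
    RepresentableLGroups (Free RepresentableLGroups G) := by
  have key : ∀ i : {x : Free RepresentableLGroups G × Free RepresentableLGroups G // x.1 ≠ x.2},
      ∃ (T : Type u) (_ : Group T) (_ : LinearOrder T) (_ : MulLeftMono T) (_ : MulRightMono T)
        (f : Free RepresentableLGroups G →* T),
        (IsLHom f ∧ Function.Surjective f) ∧ f i.1.1 ≠ f i.1.2 := by
    rintro ⟨⟨x, y⟩, hxy⟩
    induction x using Free.ind with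
    | h s =>
    induction y using Free.ind with
    | h t =>
    have h1 : ¬ ∀ (H : Type u) [Group H] [Lattice H] [MulLeftMono H] [MulRightMono H],
        RepresentableLGroups H → ∀ p : G →* H, Monotone p → s.eval p = t.eval p :=
      fun h => hxy (Free.mk_eq h)
    push Not at h1
    obtain ⟨H, _, _, _, _, hV, p, hp, hne⟩ := h1
    have hV' := hV
    obtain ⟨ι, T, _, _, _, _, f, hf, hsep⟩ := hV
    obtain ⟨i, hi⟩ : ∃ i, f i (s.eval p) ≠ f i (t.eval p) := by
      by_contra! hcon
      exact hne (hsep _ _ hcon)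
    have hl := Free.isLHom_lift (V := RepresentableLGroups) hV' p hp
    let g : Free RepresentableLGroups G →* T i := (f i).comp (Free.lift hV' p hp)
    let hm : MulLeftMono g.range := ⟨fun c a b h => mul_le_mul_right (α := T i) h c⟩
    let hm' : MulRightMono g.range := ⟨fun c a b h => mul_le_mul_left (α := T i) h c⟩
    have gs : ∀ a b, g (a ⊔ b) = g a ⊔ g b := fun a b => by
      simp only [g, MonoidHom.comp_apply, hl.map_sup, (hf i).1.map_sup]
    have gi : ∀ a b, g (a ⊓ b) = g a ⊓ g b := fun a b => by
      simp only [g, MonoidHom.comp_apply, hl.map_inf, (hf i).1.map_inf]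
    have gm : Monotone g.rangeRestrict := fun a b h => by
      change g a ≤ g b
      rw [← sup_eq_right, ← gs, sup_eq_right.2 h]
    refine ⟨g.range, inferInstance, inferInstance, hm, hm', g.rangeRestrict,
      ⟨⟨fun a b => ?_, fun a b => ?_⟩, g.rangeRestrict_surjective⟩, fun h => hi ?_⟩
    · rcases le_total (g.rangeRestrict a) (g.rangeRestrict b) with h | h
      · rw [sup_eq_right.2 h]
        exact Subtype.ext ((gs a b).trans (sup_eq_right.2 h))
      · rw [sup_eq_left.2 h]
        exact Subtype.ext ((gs a b).trans (sup_eq_left.2 h))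
    · rcases le_total (g.rangeRestrict a) (g.rangeRestrict b) with h | h
      · rw [inf_eq_left.2 h]
        exact Subtype.ext ((gi a b).trans (inf_eq_left.2 h))
      · rw [inf_eq_right.2 h]
        exact Subtype.ext ((gi a b).trans (inf_eq_right.2 h))
    · exact congrArg Subtype.val h
  choose T i1 i2 i3 i4 f hf hne using key
  refine ⟨_, T, i1, i2, i3, i4, f, hf, fun a b h => ?_⟩
  by_contra hab
  exact hne ⟨(a, b), hab⟩ (h _)

end Free

section Spectrum

variable {H : Type*} [Group H] [Lattice H]

/-- A prime subgroup of an ℓ-group: a proper, order-convex sublattice subgroup `p` such that the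
right cosets of `p` are totally ordered by `p x ≤ p y` iff `x ≤ t y` for some `t ∈ p`. -/
structure IsPrimeSubgroup (p : Subgroup H) : Prop where
  sup_mem : ∀ a ∈ p, ∀ b ∈ p, a ⊔ b ∈ p
  inf_mem : ∀ a ∈ p, ∀ b ∈ p, a ⊓ b ∈ p
  convex : ∀ a ∈ p, ∀ b ∈ p, ∀ x, a ≤ x → x ≤ b → x ∈ p
  ne_top : p ≠ ⊤
  total : ∀ x y, (∃ t ∈ p, x ≤ t * y) ∨ (∃ t ∈ p, y ≤ t * x)

theorem IsPrimeSubgroup.mem_of_mabs_mem [MulLeftMono H] [MulRightMono H] {p : Subgroup H}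
    (hp : IsPrimeSubgroup p) {a : H} (h : |a|ₘ ∈ p) : a ∈ p :=
  hp.convex _ (p.inv_mem h) _ h _ (inv_le_of_inv_le' (inv_le_mabs a)) (le_mabs_self a)

theorem IsPrimeSubgroup.mabs_mem {p : Subgroup H} (hp : IsPrimeSubgroup p) {a : H} (h : a ∈ p) :
    |a|ₘ ∈ p :=
  hp.sup_mem _ h _ (p.inv_mem h)

theorem IsPrimeSubgroup.mem_or_mem [MulLeftMono H] [MulRightMono H] {p : Subgroup H}
    (hp : IsPrimeSubgroup p) {a b : H} (h : |a|ₘ ⊓ |b|ₘ ∈ p) : a ∈ p ∨ b ∈ p := by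
  have key : ∀ x y : H, |x|ₘ ⊓ |y|ₘ ∈ p → (∃ t ∈ p, |x|ₘ ≤ t * |y|ₘ) → x ∈ p := by
    rintro x y hxy ⟨t, ht, hle⟩
    refine hp.mem_of_mabs_mem (hp.convex 1 p.one_mem _ (p.mul_mem (hp.mabs_mem ht) hxy) _
      (one_le_mabs x) ?_)
    rw [mul_inf]
    refine le_inf ?_ (hle.trans ?_)
    · exact le_mul_of_one_le_left' (one_le_mabs t)
    · exact mul_le_mul_left (le_mabs_self t) _
  rcases hp.total |a|ₘ |b|ₘ with h' | h'
  · exact Or.inl (key a b h h')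
  · exact Or.inr (key b a (by rwa [inf_comm]) h')

variable (H)

/-- The spectrum of an ℓ-group: the set of its prime subgroups. -/
def Spec : Type _ := {p : Subgroup H // IsPrimeSubgroup p}

/-- The spectral topology: the open sets are the sets `{p | ¬ A ⊆ p}` for subsets `A` of `H`. -/
instance [MulLeftMono H] [MulRightMono H] : TopologicalSpace (Spec H) where
  IsOpen U := ∃ A : Set H, U = {p | ¬ A ⊆ (p.1 : Set H)}
  isOpen_univ := ⟨Set.univ, by
    ext p
    simp only [Set.mem_univ, Set.mem_ofPred_eq, true_iff, Set.univ_subset_iff]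
    exact fun h => p.2.ne_top (SetLike.coe_injective (by simpa using h))⟩
  isOpen_inter := by
    rintro _ _ ⟨A, rfl⟩ ⟨B, rfl⟩
    refine ⟨{c | ∃ a ∈ A, ∃ b ∈ B, c = |a|ₘ ⊓ |b|ₘ}, ?_⟩
    ext p
    simp only [Set.mem_inter_iff, Set.mem_ofPred_eq, Set.not_subset]
    constructor
    · rintro ⟨⟨a, ha, hap⟩, b, hb, hbp⟩
      exact ⟨_, ⟨a, ha, b, hb, rfl⟩, fun h => (p.2.mem_or_mem h).elim hap hbp⟩
    · rintro ⟨_, ⟨a, ha, b, hb, rfl⟩, hc⟩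
      have h1 : (1 : H) ≤ |a|ₘ ⊓ |b|ₘ := le_inf (one_le_mabs a) (one_le_mabs b)
      exact ⟨⟨a, ha, fun h => hc (p.2.convex 1 p.1.one_mem _ (p.2.mabs_mem h) _ h1 inf_le_left)⟩,
        b, hb, fun h => hc (p.2.convex 1 p.1.one_mem _ (p.2.mabs_mem h) _ h1 inf_le_right)⟩
  isOpen_sUnion := by
    intro S hS
    refine ⟨⋃₀ {A | {p : Spec H | ¬ A ⊆ (p.1 : Set H)} ∈ S}, ?_⟩
    ext p
    simp only [Set.mem_sUnion, Set.mem_ofPred_eq, Set.sUnion_subset_iff, not_forall]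
    constructor
    · rintro ⟨U, hU, hp⟩
      obtain ⟨A, rfl⟩ := hS U hU
      exact ⟨A, hU, hp⟩
    · rintro ⟨A, hA, hp⟩
      exact ⟨_, hA, hp⟩

/-- The minimal spectrum of an ℓ-group: the inclusion-minimal prime subgroups. -/
def MinSpec : Type _ := {p : Spec H // Minimal (IsPrimeSubgroup (H := H)) p.1}

/-- The subspace topology inherited from the spectrum. -/
instance [MulLeftMono H] [MulRightMono H] : TopologicalSpace (MinSpec H) :=
  inferInstanceAs (TopologicalSpace {p : Spec H // Minimal (IsPrimeSubgroup (H := H)) p.1})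

end Spectrum

section Orders

variable {G : Type*} [Group G] [PartialOrder G]

/-- The positive cones of the right orders on a partially ordered group `G`, that is, of the
right-invariant total orders on `G` that extend its partial order and are not all of `G × G`. The
right order with positive cone `C` is `a ≤ b` iff `b * a⁻¹ ∈ C`. -/
structure IsRightOrderCone (C : Submonoid G) : Prop where
  ne_top : C ≠ ⊤
  total : ∀ a, a ∈ C ∨ a⁻¹ ∈ C
  of_one_le : ∀ a, 1 ≤ a → a ∈ C
  antisymm : ∀ a, a ∈ C → a⁻¹ ∈ C → a = 1

variable (G)

/-- The space of right orders on a partially ordered group. -/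
def RightOrders : Type _ := {C : Submonoid G // IsRightOrderCone C}

/-- The sets `{C | a ∈ C}` and `{C | a ∉ C}`, for `a` in `G`, form a subbase. -/
instance : TopologicalSpace (RightOrders G) :=
  TopologicalSpace.generateFrom
    {U | ∃ a : G, U = {C : RightOrders G | a ∈ C.1} ∨ U = {C : RightOrders G | a ∉ C.1}}

/-- The space of orders on a partially ordered group: the right orders that are also left
invariant, that is, those whose positive cone is closed under conjugation. -/
def Orders : Type _ := {C : RightOrders G // ∀ a ∈ C.1, ∀ g : G, g * a * g⁻¹ ∈ C.1}

/-- The subspace topology inherited from the space of right orders. -/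
instance : TopologicalSpace (Orders G) :=
  inferInstanceAs
    (TopologicalSpace {C : RightOrders G // ∀ a ∈ C.1, ∀ g : G, g * a * g⁻¹ ∈ C.1})

end Orders

end LatticeGroup

open LatticeGroup

/-! Minimal primes are studied through their positive cones: a prime subgroup `p` corresponds to the
submonoid `P = {x | p ≤ p x}`, and `p = P ∩ P⁻¹`. A prime cone is closed under `⊓`, and a join lies
in it exactly when one of the joinands does, so it is determined by its trace on a generating
subgroup `E` of the ℓ-group; if that trace is a right order `C`, the prime is minimal, because
`C ∩ C⁻¹` is trivial. Conversely, below every proper prime cone there is the positive cone of a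
right order of the whole ℓ-group, namely a lexicographic combination of enough prime cones, and
therefore the trace of a minimal prime is a right order. For orders, the same argument runs with
prime cones closed under conjugation. It remains to see that each right order of `η[G]` is the trace
of a prime cone of the free ℓ-group: let `η[G]` act on itself by left translations and take the
automorphisms of the resulting chain that do not move `1` down. -/

namespace LatticeGroup

section PrimeCones

variable {H : Type*} [Group H] [Lattice H] {P Q : Submonoid H}

/-- The positive cones `{x | p ≤ p x}` of the right-coset orders of convex ℓ-subgroups `p`. -/
structure IsLatticeCone (P : Submonoid H) : Prop where
  of_one_le : ∀ a, 1 ≤ a → a ∈ P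
  inf_mem : ∀ a ∈ P, ∀ b ∈ P, a ⊓ b ∈ P

/-- The positive cones `{x | p ≤ p x}` of the right-coset orders of convex ℓ-subgroups `p` for which
that order is total: `p` is a prime subgroup or, since `P = ⊤` is allowed, the whole group. -/
structure IsPrimeCone (P : Submonoid H) : Prop extends IsLatticeCone P where
  isMulSpanning : P.IsMulSpanning

namespace IsLatticeCone

theorem mem_of_le [MulLeftMono H] (hP : IsLatticeCone P) {a b : H} (hab : a ≤ b) (ha : a ∈ P) :
    b ∈ P := by
  simpa using P.mul_mem ha (hP.of_one_le (a⁻¹ * b) (by simpa using hab))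

theorem inf_mem_iff [MulLeftMono H] (hP : IsLatticeCone P) {a b : H} :
    a ⊓ b ∈ P ↔ a ∈ P ∧ b ∈ P :=
  ⟨fun h => ⟨hP.mem_of_le inf_le_left h, hP.mem_of_le inf_le_right h⟩,
    fun h => hP.inf_mem a h.1 b h.2⟩

theorem inf_one_mem_iff [MulLeftMono H] (hP : IsLatticeCone P) {a : H} : a ⊓ 1 ∈ P ↔ a ∈ P := by
  rw [hP.inf_mem_iff, and_iff_left P.one_mem]

theorem inf_one_mem_mulSupport_iff [MulLeftMono H] (hP : IsLatticeCone P) {a : H} :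
    a ⊓ 1 ∈ P.mulSupport ↔ a ∈ P := by
  rw [Submonoid.mem_mulSupport, hP.inf_one_mem_iff]
  exact and_iff_left (hP.of_one_le _ (one_le_inv'.2 inf_le_right))

theorem mulSupport_le_mulSupport_iff [MulLeftMono H] (hP : IsLatticeCone P) (hQ : IsLatticeCone Q) :
    P.mulSupport ≤ Q.mulSupport ↔ P ≤ Q :=
  ⟨fun h _ ha => hQ.inf_one_mem_mulSupport_iff.1 (h (hP.inf_one_mem_mulSupport_iff.2 ha)),
    fun h _ ha => ⟨h ha.1, h ha.2⟩⟩

end IsLatticeCone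

namespace IsPrimeCone

variable [MulLeftMono H] [MulRightMono H]

theorem sup_mem_iff (hP : IsPrimeCone P) {a b : H} :
    a ⊔ b ∈ P ↔ a ∈ P ∨ b ∈ P := by
  have left_mem {a b : H} (hsup : a ⊔ b ∈ P) (h : a * b⁻¹ ∈ P) : a ∈ P := by
    refine hP.mem_of_le ?_ (P.mul_mem (hP.inf_one_mem_iff.2 h) hsup)
    rw [mul_sup]
    refine sup_le (mul_le_of_le_one_left' inf_le_right) ?_
    rw [← le_mul_inv_iff_mul_le]
    exact inf_le_left
  refine ⟨fun hsup => ?_, fun h => h.elim (hP.mem_of_le le_sup_left) (hP.mem_of_le le_sup_right)⟩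
  refine (hP.isMulSpanning (a * b⁻¹)).imp (left_mem hsup) fun h => left_mem (sup_comm a b ▸ hsup) ?_
  rwa [mul_inv_rev, inv_inv] at h

theorem isPrimeSubgroup_mulSupport (hP : IsPrimeCone P) (hne : P ≠ ⊤) :
    IsPrimeSubgroup P.mulSupport where
  sup_mem a ha b hb := by
    rw [Submonoid.mem_mulSupport] at *
    exact ⟨hP.mem_of_le le_sup_left ha.1, inv_sup a b ▸ hP.inf_mem _ ha.2 _ hb.2⟩
  inf_mem a ha b hb := by
    rw [Submonoid.mem_mulSupport] at *
    exact ⟨hP.inf_mem _ ha.1 _ hb.1, hP.mem_of_le (inv_le_inv_iff.2 inf_le_left) ha.2⟩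
  convex a ha b hb x hax hxb :=
    ⟨hP.mem_of_le hax ha.1, hP.mem_of_le (inv_le_inv_iff.2 hxb) hb.2⟩
  ne_top h := hne (eq_top_iff.2 fun a _ => (h ▸ Subgroup.mem_top a : a ∈ P.mulSupport).1)
  total x y := by
    have exists_le_mul {x y : H} (h : y * x⁻¹ ∈ P) : ∃ t ∈ P.mulSupport, x ≤ t * y := by
      refine ⟨_, inv_mem (hP.inf_one_mem_mulSupport_iff.2 h), ?_⟩
      rw [le_inv_mul_iff_mul_le, inf_mul, inv_mul_cancel_right]
      exact inf_le_left
    refine (hP.isMulSpanning (y * x⁻¹)).imp exists_le_mul fun h => exists_le_mul ?_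
    rwa [mul_inv_rev, inv_inv] at h

end IsPrimeCone

theorem isLatticeCone_oneLE [MulLeftMono H] : IsLatticeCone (Submonoid.oneLE H) where
  of_one_le _ ha := ha
  inf_mem _ ha _ hb := le_inf ha hb

namespace IsPrimeSubgroup

variable [MulLeftMono H] [MulRightMono H] {p q : Subgroup H}

/-- The prime cone `{x | p ≤ p x}` of a prime subgroup `p`. -/
def cone (hp : IsPrimeSubgroup p) : Submonoid H where
  carrier := {x | x ⊓ 1 ∈ p}
  one_mem' := by simp [p.one_mem]
  mul_mem' {a b} ha hb := by
    refine hp.convex _ (p.mul_mem ha hb) 1 p.one_mem _ (le_inf ?_ ?_) inf_le_right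
    · exact mul_le_mul' inf_le_left inf_le_left
    · exact mul_le_one' inf_le_right inf_le_right

theorem mem_cone (hp : IsPrimeSubgroup p) {x : H} : x ∈ hp.cone ↔ x ⊓ 1 ∈ p := Iff.rfl

theorem mulSupport_cone (hp : IsPrimeSubgroup p) : hp.cone.mulSupport = p := by
  ext x
  rw [Submonoid.mem_mulSupport, hp.mem_cone, hp.mem_cone]
  refine ⟨fun ⟨hx, hx'⟩ => ?_, fun h =>
    ⟨hp.inf_mem _ h _ p.one_mem, hp.inf_mem _ (p.inv_mem h) _ p.one_mem⟩⟩
  refine hp.convex _ hx _ (p.inv_mem hx') x inf_le_left ?_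
  rw [inv_inf, inv_inv]
  exact le_sup_left

theorem cone_ne_top (hp : IsPrimeSubgroup p) : hp.cone ≠ ⊤ := fun h => hp.ne_top <| by
  rw [← hp.mulSupport_cone, h]
  exact eq_top_iff.2 fun _ _ => ⟨trivial, trivial⟩

theorem isPrimeCone_cone (hp : IsPrimeSubgroup p) : IsPrimeCone hp.cone where
  of_one_le a ha := by
    rw [hp.mem_cone, inf_eq_right.2 ha]
    exact p.one_mem
  inf_mem a ha b hb := by
    rw [hp.mem_cone, inf_inf_distrib_right]
    exact hp.inf_mem _ ha _ hb
  isMulSpanning a := by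
    have mem_cone_of_le {t x : H} (ht : t ∈ p) (h : t ≤ x) : x ∈ hp.cone :=
      hp.convex _ (hp.inf_mem _ ht _ p.one_mem) _ p.one_mem _ (inf_le_inf_right _ h) inf_le_right
    obtain ⟨t, ht, h⟩ | ⟨t, ht, h⟩ := hp.total 1 a
    · exact Or.inl (mem_cone_of_le (p.inv_mem ht) (inv_le_iff_one_le_mul'.2 h))
    · exact Or.inr (mem_cone_of_le (p.inv_mem ht) (inv_le_inv_iff.2 (by rwa [mul_one] at h)))

end IsPrimeSubgroup

theorem IsPrimeCone.cone_mulSupport [MulLeftMono H] [MulRightMono H] (hP : IsPrimeCone P)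
    (h : IsPrimeSubgroup P.mulSupport) : h.cone = P := by
  ext x
  rw [h.mem_cone, hP.inf_one_mem_mulSupport_iff]

end PrimeCones

section ConjInvariance

/-- `P` is closed under conjugation by the elements of `K`. -/
def ConjInvariant {G : Type*} [Group G] (K : Subgroup G) (P : Submonoid G) : Prop :=
  ∀ g ∈ K, ∀ a ∈ P, g * a * g⁻¹ ∈ P

theorem ConjInvariant.conj_mem_iff {G : Type*} [Group G] {K : Subgroup G} {P : Submonoid G}
    (hP : ConjInvariant K P) {g a : G} (hg : g ∈ K) : g * a * g⁻¹ ∈ P ↔ a ∈ P :=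
  ⟨fun h => by simpa [mul_assoc] using hP g⁻¹ (inv_mem hg) _ h, hP g hg a⟩

theorem ConjInvariant.conj_mem_mulSupport_iff {G : Type*} [Group G] {K : Subgroup G}
    {P : Submonoid G} (hP : ConjInvariant K P) {g a : G} (hg : g ∈ K) :
    g * a * g⁻¹ ∈ P.mulSupport ↔ a ∈ P.mulSupport := by
  rw [Submonoid.mem_mulSupport, Submonoid.mem_mulSupport, conj_inv, hP.conj_mem_iff hg,
    hP.conj_mem_iff hg]

variable {H : Type*} [Group H] [Lattice H]

/-- Representability relative to a group `K` of conjugations: for `K = ⊤` the inequality is an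
identity characterizing the representable ℓ-groups, and for `K = ⊥` it is void. It is what makes
the prime cones invariant under `K` separate the elements of `H`. -/
def ConjRepresentable (K : Subgroup H) : Prop :=
  ∀ g ∈ K, ∀ a b, (a ⊔ b) ⊓ (g * (a ⊔ b) * g⁻¹) ≤ a ⊔ g * b * g⁻¹

theorem conjRepresentable_bot : ConjRepresentable (⊥ : Subgroup H) := fun g hg a b => by
  rw [Subgroup.mem_bot.1 hg]
  simp

theorem conjRepresentable_of_linearOrder {T : Type*} [Group T] [LinearOrder T] (K : Subgroup T) :
    ConjRepresentable K := fun g _ a b => by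
  rcases le_total b a with h | h
  · exact inf_le_left.trans (by simp [h])
  · exact inf_le_right.trans (by simp [h])

theorem AbelianLGroups.conjRepresentable (hH : AbelianLGroups H) (K : Subgroup H) :
    ConjRepresentable K := fun g _ a b => by
  rw [hH g b, mul_inv_cancel_right]
  exact inf_le_left

theorem RepresentableLGroups.conjRepresentable (hH : RepresentableLGroups H) (K : Subgroup H) :
    ConjRepresentable K := fun g _ a b => by
  obtain ⟨ι, T, _, _, _, _, f, hf, hsep⟩ := hH
  refine sup_eq_right.1 (hsep _ _ fun i => ?_)
  simp only [(hf i).1.map_sup, (hf i).1.map_inf, map_mul, map_inv]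
  exact sup_eq_right.2 (conjRepresentable_of_linearOrder ⊤ (f i g) trivial (f i a) (f i b))

end ConjInvariance

section PrimeSeparation

variable {H : Type*} [Group H] [Lattice H] [MulLeftMono H] [MulRightMono H] {K : Subgroup H}
  {P Q : Submonoid H} {M : Set H}

theorem sup_inf_sup_le (a b c : H) : (c ⊔ a) ⊓ (c ⊔ b) ≤ c ⊔ a ⊓ b := by
  have sup_le_mul {d x : H} (h : d ≤ x) : c ⊔ x ≤ x * d⁻¹ * (c ⊔ d) := by
    rw [mul_sup, inv_mul_cancel_right]
    exact sup_le_sup (le_mul_of_one_le_left' (le_mul_inv_iff_mul_le.2 (by rwa [one_mul]))) le_rfl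
  calc (c ⊔ a) ⊓ (c ⊔ b)
      ≤ (a * (a ⊓ b)⁻¹ * (c ⊔ a ⊓ b)) ⊓ (b * (a ⊓ b)⁻¹ * (c ⊔ a ⊓ b)) :=
        inf_le_inf (sup_le_mul inf_le_left) (sup_le_mul inf_le_right)
    _ = c ⊔ a ⊓ b := by rw [← inf_mul, ← inf_mul, mul_inv_cancel, one_mul]

theorem sup_mul_sup_le {c x y : H} (hc : c ≤ 1) (hx : x ≤ 1) (hy : y ≤ 1) :
    (c ⊔ x) * (c ⊔ y) ≤ c ⊔ x * y := by
  rw [sup_mul, mul_sup c y x]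
  exact sup_le (le_sup_of_le_left (mul_le_of_le_one_right' (sup_le hc hy)))
    (sup_le_sup (mul_le_of_le_one_left' hx) le_rfl)

/-- The cone of all `x` with `c ⊔ x ∈ P`: the polar of `c` modulo `P`. -/
def IsLatticeCone.colon (hP : IsLatticeCone P) {c : H} (hc : c ≤ 1) : Submonoid H where
  carrier := {x | c ⊔ x ∈ P}
  one_mem' := hP.of_one_le _ le_sup_right
  mul_mem' {x y} hx hy := by
    have inf_one_mem {x : H} (hx : c ⊔ x ∈ P) : c ⊔ x ⊓ 1 ∈ P :=
      hP.mem_of_le (sup_inf_sup_le x 1 c) (hP.inf_mem _ hx _ (hP.of_one_le _ le_sup_right))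
    have hmul := P.mul_mem (inf_one_mem hx) (inf_one_mem hy)
    exact hP.mem_of_le (sup_le_sup le_rfl (mul_le_mul' inf_le_left inf_le_left))
      (hP.mem_of_le (sup_mul_sup_le hc inf_le_right inf_le_right) hmul)

namespace IsLatticeCone

theorem isLatticeCone_colon (hP : IsLatticeCone P) {c : H} (hc : c ≤ 1) :
    IsLatticeCone (hP.colon hc) where
  of_one_le _ ha := hP.of_one_le _ (le_sup_of_le_right ha)
  inf_mem _ ha _ hb := hP.mem_of_le (sup_inf_sup_le _ _ c) (hP.inf_mem _ ha _ hb)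

theorem le_colon (hP : IsLatticeCone P) {c : H} (hc : c ≤ 1) : P ≤ hP.colon hc :=
  fun _ => hP.mem_of_le le_sup_right

theorem conjInvariant_colon (hK : ConjRepresentable K) (hP : IsLatticeCone P)
    (hPK : ConjInvariant K P) {c : H} (hc : c ≤ 1) : ConjInvariant K (hP.colon hc) :=
  fun g hg x hx => hP.mem_of_le (hK g hg c x) (hP.inf_mem _ hx _ (hPK g hg _ hx))

end IsLatticeCone

theorem conjInvariant_oneLE : ConjInvariant K (Submonoid.oneLE H) := fun g _ a ha => by
  simpa using mul_le_mul_left (mul_le_mul_right (show 1 ≤ a from ha) g) g⁻¹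

theorem exists_sup_mem_of_maximal_disjoint (hK : ConjRepresentable K)
    (hP : Maximal (fun P => IsLatticeCone P ∧ ConjInvariant K P ∧ Disjoint (P : Set H) M) P)
    {c x : H} (hc : c ≤ 1) (hx : x ∉ P) (hcx : c ⊔ x ∈ P) : ∃ m ∈ M, c ⊔ m ∈ P := by
  obtain ⟨hlat, hinv, -⟩ := hP.prop
  by_contra! hM
  refine hx (hP.le_of_ge ⟨hlat.isLatticeCone_colon hc, hlat.conjInvariant_colon hK hinv hc, ?_⟩
    (hlat.le_colon hc) hcx)
  exact Set.disjoint_right.2 hM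

theorem isPrimeCone_of_maximal_disjoint (hK : ConjRepresentable K) (hM : SupClosed M)
    (hM1 : ∀ m ∈ M, m ≤ 1)
    (hP : Maximal (fun P => IsLatticeCone P ∧ ConjInvariant K P ∧ Disjoint (P : Set H) M) P) :
    IsPrimeCone P where
  toIsLatticeCone := hP.prop.1
  isMulSpanning a := by
    obtain ⟨hlat, -, hdisj⟩ := hP.prop
    by_contra! ha
    rw [← hlat.inf_one_mem_iff, ← hlat.inf_one_mem_iff (a := a⁻¹)] at ha
    have hsup : a ⊓ 1 ⊔ a⁻¹ ⊓ 1 = 1 := by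
      rw [← inv_inj, inv_sup, inv_inf, inv_inf, inv_inv, inv_one, inf_comm]
      exact oneLePart_inf_leOnePart_eq_one a
    obtain ⟨m, hm, ham⟩ := exists_sup_mem_of_maximal_disjoint hK hP inf_le_right ha.2
      (hsup ▸ P.one_mem)
    obtain ⟨m', hm', hmm'⟩ := exists_sup_mem_of_maximal_disjoint hK hP (hM1 m hm) ha.1
      (sup_comm _ m ▸ ham)
    exact Set.disjoint_left.1 hdisj hmm' (hM hm hm')

theorem exists_maximal_isLatticeCone_disjoint (K : Subgroup H) (hM1 : ∀ m ∈ M, m < 1) :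
    ∃ P, Maximal (fun P => IsLatticeCone P ∧ ConjInvariant K P ∧ Disjoint (P : Set H) M) P := by
  let S : Set (Submonoid H) :=
    {P | IsLatticeCone P ∧ ConjInvariant K P ∧ Disjoint (P : Set H) M}
  have exists_upperBound : ∀ 𝒞 ⊆ S, IsChain (· ≤ ·) 𝒞 → ∀ P₀ ∈ 𝒞, ∃ Q ∈ S, ∀ P ∈ 𝒞, P ≤ Q := by
    intro 𝒞 h𝒞 hchain P₀ hP₀
    have mem_sSup {a : H} : a ∈ sSup 𝒞 ↔ ∃ P ∈ 𝒞, a ∈ P :=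
      Submonoid.mem_sSup_of_directedOn ⟨P₀, hP₀⟩ hchain.directedOn
    refine ⟨sSup 𝒞, ⟨⟨fun a ha => ?_, fun a ha b hb => ?_⟩, fun g hg a ha => ?_, ?_⟩,
      fun P hP => le_sSup hP⟩
    · exact mem_sSup.2 ⟨P₀, hP₀, (h𝒞 hP₀).1.of_one_le a ha⟩
    · obtain ⟨P, hP, ha⟩ := mem_sSup.1 ha
      obtain ⟨Q, hQ, hb⟩ := mem_sSup.1 hb
      obtain ⟨R, hR, hPR, hQR⟩ := hchain.directedOn P hP Q hQ
      exact mem_sSup.2 ⟨R, hR, (h𝒞 hR).1.inf_mem a (hPR ha) b (hQR hb)⟩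
    · obtain ⟨P, hP, ha⟩ := mem_sSup.1 ha
      exact mem_sSup.2 ⟨P, hP, (h𝒞 hP).2.1 g hg a ha⟩
    · refine Set.disjoint_left.2 fun a ha => ?_
      obtain ⟨P, hP, ha⟩ := mem_sSup.1 ha
      exact Set.disjoint_left.1 (h𝒞 hP).2.2 ha
  have oneLE_mem : Submonoid.oneLE H ∈ S :=
    ⟨isLatticeCone_oneLE, conjInvariant_oneLE, Set.disjoint_left.2 fun m h hm =>
      (hM1 m hm).not_ge h⟩
  obtain ⟨P, -, hP⟩ := zorn_le_nonempty₀ S exists_upperBound _ oneLE_mem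
  exact ⟨P, hP⟩

theorem exists_isPrimeCone_disjoint (hK : ConjRepresentable K) (hM : SupClosed M)
    (hM1 : ∀ m ∈ M, m < 1) :
    ∃ P : Submonoid H, IsPrimeCone P ∧ ConjInvariant K P ∧ Disjoint (P : Set H) M := by
  obtain ⟨P, hP⟩ := exists_maximal_isLatticeCone_disjoint K hM1
  exact ⟨P, isPrimeCone_of_maximal_disjoint hK hM (fun m hm => (hM1 m hm).le) hP, hP.prop.2⟩

theorem exists_isPrimeCone_notMem (hK : ConjRepresentable K) {x : H} (hx : ¬ 1 ≤ x) :
    ∃ P : Submonoid H, IsPrimeCone P ∧ ConjInvariant K P ∧ x ∉ P := by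
  obtain ⟨P, hP, hinv, hdisj⟩ := exists_isPrimeCone_disjoint hK
    (supClosed_singleton (a := x ⊓ 1)) fun m hm => by
      rw [Set.mem_singleton_iff.1 hm]
      exact inf_lt_right.2 hx
  exact ⟨P, hP, hinv, fun h => Set.disjoint_left.1 hdisj (hP.inf_one_mem_iff.2 h) rfl⟩

theorem IsPrimeCone.exists_conjInvariant_le (hK : ConjRepresentable K) (hQ : IsPrimeCone Q) :
    ∃ P : Submonoid H, IsPrimeCone P ∧ ConjInvariant K P ∧ P ≤ Q := by
  obtain ⟨P, hP, hinv, hdisj⟩ := exists_isPrimeCone_disjoint hK (M := {x | x ≤ 1 ∧ x ∉ Q})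
    (fun x hx y hy => ⟨sup_le hx.1 hy.1, fun h => (hQ.sup_mem_iff.1 h).elim hx.2 hy.2⟩)
    fun m hm => hm.1.lt_of_ne fun h => hm.2 (h ▸ Q.one_mem)
  refine ⟨P, hP, hinv, fun x hx => hQ.inf_one_mem_iff.1 ?_⟩
  by_contra h
  exact Set.disjoint_left.1 hdisj (hP.inf_one_mem_iff.2 hx) ⟨inf_le_right, h⟩

end PrimeSeparation

section LexicographicCone

variable {G ι : Type*} [Group G] [LinearOrder ι] [WellFoundedLT ι] {N : ι → Submonoid G}
  {Q : Submonoid G} {K : Subgroup G} {a b : G}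

theorem mem_and_mem_of_mul_mem_mulSupport (ha : a ∈ Q) (hb : b ∈ Q) (hab : a * b ∈ Q.mulSupport) :
    a ∈ Q.mulSupport ∧ b ∈ Q.mulSupport := by
  rw [Submonoid.mem_mulSupport, mul_inv_rev] at hab
  refine ⟨⟨ha, ?_⟩, hb, ?_⟩
  · simpa using Q.mul_mem hb hab.2
  · simpa using Q.mul_mem hab.2 ha

/-- The lexicographic combination of the cones `N i`: an element is tested by the first `N i` whose
support it leaves. -/
def lexCone (N : ι → Submonoid G) : Submonoid G where
  carrier := {a | ∀ i, (∀ j < i, a ∈ (N j).mulSupport) → a ∈ N i}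
  one_mem' i _ := (N i).one_mem
  mul_mem' {a b} ha hb i hi := by
    have hsupp : ∀ j < i, a ∈ (N j).mulSupport ∧ b ∈ (N j).mulSupport := by
      intro j
      induction j using WellFoundedLT.induction with
      | ind j ih =>
        intro hj
        exact mem_and_mem_of_mul_mem_mulSupport (ha j fun k hk => (ih k hk (hk.trans hj)).1)
          (hb j fun k hk => (ih k hk (hk.trans hj)).2) (hi j hj)
    exact (N i).mul_mem (ha i fun j hj => (hsupp j hj).1) (hb i fun j hj => (hsupp j hj).2)

theorem mem_lexCone_of_notMem_mulSupport {i : ι} (hlt : ∀ j < i, a ∈ (N j).mulSupport)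
    (ha : a ∈ N i) (hi : a ∉ (N i).mulSupport) : a ∈ lexCone N := fun k hk => by
  rcases lt_trichotomy k i with h | rfl | h
  · exact (hlt k h).1
  · exact ha
  · exact absurd (hk i h) hi

theorem lexCone_le_bot [OrderBot ι] : lexCone N ≤ N ⊥ :=
  fun _ ha => ha ⊥ fun _ h => absurd h not_lt_bot

theorem isMulSpanning_lexCone (hN : ∀ i, (N i).IsMulSpanning) : (lexCone N).IsMulSpanning := by
  intro a
  by_cases h : ∀ i, a ∈ (N i).mulSupport
  · exact Or.inl fun i _ => (h i).1
  · push Not at h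
    obtain ⟨i, hi, hmin⟩ := exists_minimal_of_wellFoundedLT (fun i => a ∉ (N i).mulSupport) h
    have hlt : ∀ j < i, a ∈ (N j).mulSupport := fun j hj => by
      by_contra hj'
      exact hj.not_ge (hmin hj' hj.le)
    refine (hN i a).imp (mem_lexCone_of_notMem_mulSupport hlt · hi) fun ha => ?_
    exact mem_lexCone_of_notMem_mulSupport (fun j hj => inv_mem (hlt j hj)) ha
      (mt inv_mem_iff.1 hi)

theorem isMulPointed_lexCone (hN : ∀ a, (∀ i, a ∈ (N i).mulSupport) → a = 1) :
    (lexCone N).IsMulPointed := fun a ha ha' => hN a fun i => by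
  induction i using WellFoundedLT.induction with
  | ind i ih => exact ⟨ha i ih, ha' i fun j hj => inv_mem (ih j hj)⟩

theorem conjInvariant_lexCone (hN : ∀ i, ConjInvariant K (N i)) : ConjInvariant K (lexCone N) :=
  fun g hg a ha i hi =>
    hN i g hg a (ha i fun j hj => ((hN j).conj_mem_mulSupport_iff hg).1 (hi j hj))

end LexicographicCone

theorem IsPrimeCone.exists_isRightOrderCone_le {H : Type*} [Group H] [Lattice H] [MulLeftMono H]
    [MulRightMono H] {K : Subgroup H} {P : Submonoid H} (hK : ConjRepresentable K)
    (hP : IsPrimeCone P) (hne : P ≠ ⊤) :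
    ∃ C : Submonoid H, IsRightOrderCone C ∧ ConjInvariant K C ∧ C ≤ P := by
  obtain ⟨P₀, hP₀, hinv₀, hle₀⟩ := hP.exists_conjInvariant_le hK
  choose S hS hinvS hnotMem using fun x : {x : H // ¬ 1 ≤ x} => exists_isPrimeCone_notMem hK x.2
  obtain ⟨_, _⟩ := exists_wellFoundedLT {x : H // ¬ 1 ≤ x}
  let N : WithBot {x : H // ¬ 1 ≤ x} → Submonoid H := fun i => i.recBotCoe P₀ S
  have hN : ∀ i, IsPrimeCone (N i) := WithBot.forall.2 ⟨hP₀, hS⟩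
  have hinv : ∀ i, ConjInvariant K (N i) := WithBot.forall.2 ⟨hinv₀, hinvS⟩
  have one_le {a : H} (ha : ∀ i, a ∈ N i) : 1 ≤ a := by
    by_contra h
    exact hnotMem ⟨a, h⟩ (ha (⟨a, h⟩ : {x : H // ¬ 1 ≤ x}))
  have hpointed : (lexCone N).IsMulPointed := isMulPointed_lexCone fun a ha =>
    le_antisymm (one_le_inv'.1 (one_le fun i => (ha i).2)) (one_le fun i => (ha i).1)
  have hle : lexCone N ≤ P := (lexCone_le_bot (N := N)).trans hle₀
  exact ⟨lexCone N,
    { ne_top := ne_top_of_le_ne_top hne hle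
      total := isMulSpanning_lexCone fun i => (hN i).isMulSpanning
      of_one_le := fun a ha i _ => (hN i).of_one_le a ha
      antisymm := hpointed }, conjInvariant_lexCone hinv, hle⟩

section Generation

variable {H : Type*} [Group H] [Lattice H] [MulLeftMono H] [MulRightMono H] {E : Subgroup H}
  {P Q : Submonoid H}

theorem mul_mem_latticeClosure {a b : H} (ha : a ∈ latticeClosure (E : Set H))
    (hb : b ∈ latticeClosure (E : Set H)) : a * b ∈ latticeClosure (E : Set H) := by
  have hE := isSublattice_latticeClosure (s := (E : Set H))
  induction ha using latticeClosure_sup_inf_induction with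
  | mem a ha =>
    induction hb using latticeClosure_sup_inf_induction with
    | mem b hb => exact subset_latticeClosure (mul_mem (S := Subgroup H) ha hb)
    | sup b _ c _ hb hc => rw [mul_sup]; exact hE.supClosed hb hc
    | inf b _ c _ hb hc => rw [mul_inf]; exact hE.infClosed hb hc
  | sup a _ c _ ha hc => rw [sup_mul]; exact hE.supClosed ha hc
  | inf a _ c _ ha hc => rw [inf_mul]; exact hE.infClosed ha hc

theorem inv_mem_latticeClosure {a : H} (ha : a ∈ latticeClosure (E : Set H)) :
    a⁻¹ ∈ latticeClosure (E : Set H) := by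
  have hE := isSublattice_latticeClosure (s := (E : Set H))
  induction ha using latticeClosure_sup_inf_induction with
  | mem a ha => exact subset_latticeClosure (inv_mem (S := Subgroup H) ha)
  | sup a _ b _ ha hb => rw [inv_sup]; exact hE.infClosed ha hb
  | inf a _ b _ ha hb => rw [inv_inf]; exact hE.supClosed ha hb

namespace IsPrimeCone

theorem le_of_comap_le (hP : IsPrimeCone P) (hQ : IsPrimeCone Q)
    (hE : latticeClosure (E : Set H) = Set.univ)
    (h : P.comap E.subtype ≤ Q.comap E.subtype) : P ≤ Q := fun a ha => by
  have haE : a ∈ latticeClosure (E : Set H) := hE ▸ Set.mem_univ a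
  induction haE using latticeClosure_sup_inf_induction with
  | mem a haE => exact @h ⟨a, haE⟩ ha
  | sup a _ b _ iha ihb => exact hQ.sup_mem_iff.2 ((hP.sup_mem_iff.1 ha).imp iha ihb)
  | inf a _ b _ iha ihb => exact hQ.inf_mem_iff.2 ((hP.inf_mem_iff.1 ha).imp iha ihb)

theorem eq_of_comap_eq (hP : IsPrimeCone P) (hQ : IsPrimeCone Q)
    (hE : latticeClosure (E : Set H) = Set.univ)
    (h : P.comap E.subtype = Q.comap E.subtype) : P = Q :=
  le_antisymm (hP.le_of_comap_le hQ hE h.le) (hQ.le_of_comap_le hP hE h.ge)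

theorem comap_ne_top (hP : IsPrimeCone P) (hne : P ≠ ⊤)
    (hE : latticeClosure (E : Set H) = Set.univ) : P.comap E.subtype ≠ ⊤ := fun h => by
  have htop : IsPrimeCone (⊤ : Submonoid H) :=
    { of_one_le := fun _ _ => trivial
      inf_mem := fun _ _ _ _ => trivial
      isMulSpanning := fun _ => Or.inl trivial }
  exact hne (hP.eq_of_comap_eq htop hE (h.trans (Submonoid.comap_top _).symm))

theorem isClopen_setOf_mem {X : Type*} [TopologicalSpace X] {F : X → Submonoid H}
    (hF : ∀ x, IsPrimeCone (F x)) (hE : latticeClosure (E : Set H) = Set.univ)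
    (h : ∀ e : E, IsClopen {x | (e : H) ∈ F x}) (a : H) : IsClopen {x | a ∈ F x} := by
  have haE : a ∈ latticeClosure (E : Set H) := hE ▸ Set.mem_univ a
  induction haE using latticeClosure_sup_inf_induction with
  | mem a ha => exact h ⟨a, ha⟩
  | sup a _ b _ iha ihb =>
    simp only [(hF _).sup_mem_iff]
    exact iha.union ihb
  | inf a _ b _ iha ihb =>
    simp only [(hF _).inf_mem_iff]
    exact iha.inter ihb

theorem minimal_mulSupport (hP : IsPrimeCone P) (hne : P ≠ ⊤)
    (hE : latticeClosure (E : Set H) = Set.univ) (hpt : (P.comap E.subtype).IsMulPointed) :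
    Minimal IsPrimeSubgroup P.mulSupport := by
  refine ⟨hP.isPrimeSubgroup_mulSupport hne, fun q hq hqP => ?_⟩
  have hQ := hq.isPrimeCone_cone
  rw [← hq.mulSupport_cone, hQ.mulSupport_le_mulSupport_iff hP.toIsLatticeCone] at hqP
  have hmax : Maximal Submonoid.IsMulPointed (hq.cone.comap E.subtype) :=
    Submonoid.IsMulSpanning.maximal_isMulPointed
      (fun a ha ha' => hpt a (hqP ha) (hqP ha')) fun a => hQ.isMulSpanning a
  rw [← hq.mulSupport_cone, hP.mulSupport_le_mulSupport_iff hQ.toIsLatticeCone]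
  exact hP.le_of_comap_le hQ hE (hmax.le_of_ge hpt (Submonoid.monotone_comap hqP))

theorem exists_rightOrders_le_comap {K : Subgroup H} (hK : ConjRepresentable K)
    (hP : IsPrimeCone P) (hne : P ≠ ⊤) (hE : latticeClosure (E : Set H) = Set.univ) :
    ∃ C : RightOrders E, ConjInvariant (K.subgroupOf E) C.1 ∧ C.1 ≤ P.comap E.subtype := by
  obtain ⟨C, hC, hinv, hle⟩ := hP.exists_isRightOrderCone_le hK hne
  exact ⟨⟨C.comap E.subtype,
    { ne_top := ne_top_of_le_ne_top (hP.comap_ne_top hne hE) (Submonoid.monotone_comap hle)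
      total := fun a => hC.total a
      of_one_le := fun a ha => hC.of_one_le a ha
      antisymm := fun a ha ha' => Subtype.ext (hC.antisymm a ha ha') }⟩,
    fun g hg a ha => hinv g hg a ha, fun a ha => hle ha⟩

end IsPrimeCone

end Generation

section Homeomorphism

theorem RightOrders.isClopen_setOf_mem {G : Type*} [Group G] [PartialOrder G] (a : G) :
    IsClopen {C : RightOrders G | a ∈ C.1} :=
  ⟨⟨TopologicalSpace.isOpen_generateFrom_of_mem ⟨a, Or.inr rfl⟩⟩,
    TopologicalSpace.isOpen_generateFrom_of_mem ⟨a, Or.inl rfl⟩⟩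

theorem RightOrders.continuous_of_isOpen {G X : Type*} [Group G] [PartialOrder G]
    [TopologicalSpace X] {f : X → RightOrders G} (hf : ∀ a, IsOpen {x | a ∉ (f x).1}) :
    Continuous f := by
  refine continuous_generateFrom_iff.2 ?_
  rintro _ ⟨a, rfl | rfl⟩
  · rw [Set.preimage_ofPred_eq]
    obtain rfl | ha := eq_or_ne a 1
    · simp only [one_mem, Set.ofPred_true, isOpen_univ]
    · convert hf a⁻¹ using 3 with x
      exact ⟨fun h h' => ha ((f x).2.antisymm a h h'), ((f x).2.total a).resolve_right⟩
  · exact hf a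

variable {H : Type*} [Group H] [Lattice H] [MulLeftMono H] [MulRightMono H] {E : Subgroup H}

theorem MinSpec.isOpen_setOf_notMem (a : H) : IsOpen {p : MinSpec H | a ∉ p.1.1} :=
  ⟨{p : Spec H | a ∉ p.1}, ⟨{a}, by simp⟩, rfl⟩

theorem MinSpec.continuous_of_isOpen {X : Type*} [TopologicalSpace X] {f : X → MinSpec H}
    (hf : ∀ a, IsOpen {x | a ∉ (f x).1.1}) : Continuous f := by
  refine continuous_induced_rng.2 ⟨?_⟩
  rintro _ ⟨A, rfl⟩
  convert isOpen_biUnion fun a (_ : a ∈ A) => hf a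
  ext x
  simp only [Set.mem_preimage, Set.mem_ofPred_eq, Set.not_subset, Set.mem_iUnion, exists_prop]
  rfl

theorem comap_cone_mem_of_minimal (hE : latticeClosure (E : Set H) = Set.univ)
    {𝒪 : Set (RightOrders E)}
    (hext : ∀ C ∈ 𝒪, ∃ P : Submonoid H, IsPrimeCone P ∧ P.comap E.subtype = C.1)
    (hle : ∀ P : Submonoid H, IsPrimeCone P → P ≠ ⊤ → ∃ C ∈ 𝒪, C.1 ≤ P.comap E.subtype)
    (p : MinSpec H) : ∃ C ∈ 𝒪, C.1 = p.1.2.cone.comap E.subtype := by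
  obtain ⟨⟨p, hp⟩, hmin⟩ := p
  obtain ⟨C, hC, hCp⟩ := hle hp.cone hp.isPrimeCone_cone hp.cone_ne_top
  obtain ⟨Q, hQ, hQC⟩ := hext C hC
  have hQp : Q ≤ hp.cone := hQ.le_of_comap_le hp.isPrimeCone_cone hE (hQC ▸ hCp)
  have hpQ : hp.cone ≤ Q := by
    rw [← hp.isPrimeCone_cone.mulSupport_le_mulSupport_iff hQ.toIsLatticeCone, hp.mulSupport_cone]
    refine hmin.le_of_le
      (hQ.isPrimeSubgroup_mulSupport (ne_top_of_le_ne_top hp.cone_ne_top hQp)) ?_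
    refine le_of_le_of_eq ?_ hp.mulSupport_cone
    exact (hQ.mulSupport_le_mulSupport_iff hp.isPrimeCone_cone.toIsLatticeCone).2 hQp
  exact ⟨C, hC, by rw [← hQC, le_antisymm hQp hpQ]⟩

theorem nonempty_minSpec_homeomorph (hE : latticeClosure (E : Set H) = Set.univ)
    {𝒪 : Set (RightOrders E)}
    (hext : ∀ C ∈ 𝒪, ∃ P : Submonoid H, IsPrimeCone P ∧ P.comap E.subtype = C.1)
    (hle : ∀ P : Submonoid H, IsPrimeCone P → P ≠ ⊤ → ∃ C ∈ 𝒪, C.1 ≤ P.comap E.subtype) :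
    Nonempty (MinSpec H ≃ₜ 𝒪) := by
  choose C hC𝒪 hC using comap_cone_mem_of_minimal hE hext hle
  choose P hP hPC using fun C : 𝒪 => hext C.1 C.2
  have hne (C : 𝒪) : P C ≠ ⊤ := fun h => C.1.2.ne_top (by rw [← hPC, h, Submonoid.comap_top])
  have hmin (C : 𝒪) : Minimal IsPrimeSubgroup (P C).mulSupport :=
    (hP C).minimal_mulSupport (hne C) hE (hPC C ▸ C.1.2.antisymm)
  have hclopen (a : H) : IsClopen {C : 𝒪 | a ∈ P C} := by
    refine IsPrimeCone.isClopen_setOf_mem hP hE (fun e => ?_) a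
    have hmem (C : 𝒪) : (e : H) ∈ P C ↔ e ∈ C.1.1 := hPC C ▸ Iff.rfl
    simp only [hmem]
    exact (RightOrders.isClopen_setOf_mem e).preimage continuous_subtype_val
  exact ⟨{
    toFun p := ⟨C p, hC𝒪 p⟩
    invFun C := ⟨⟨(P C).mulSupport, (hmin C).prop⟩, hmin C⟩
    left_inv p := Subtype.ext <| Subtype.ext <| by
      have hcone : P ⟨C p, hC𝒪 p⟩ = p.1.2.cone :=
        (hP _).eq_of_comap_eq p.1.2.isPrimeCone_cone hE ((hPC _).trans (hC p))
      exact (congrArg Submonoid.mulSupport hcone).trans p.1.2.mulSupport_cone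
    right_inv D := Subtype.ext <| Subtype.ext <| by
      refine (hC _).trans ?_
      rw [(hP D).cone_mulSupport, hPC]
    continuous_toFun := by
      refine (RightOrders.continuous_of_isOpen fun e => ?_).subtype_mk _
      simp only [hC, Submonoid.mem_comap, IsPrimeSubgroup.mem_cone]
      exact MinSpec.isOpen_setOf_notMem _
    continuous_invFun := by
      refine MinSpec.continuous_of_isOpen fun a => ?_
      simp only [Submonoid.mem_mulSupport]
      exact ((hclopen a).inter (hclopen a⁻¹)).compl.isOpen }⟩

theorem nonempty_minSpec_homeomorph_rightOrders (hE : latticeClosure (E : Set H) = Set.univ)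
    (hext : ∀ C : RightOrders E, ∃ P : Submonoid H, IsPrimeCone P ∧ P.comap E.subtype = C.1) :
    Nonempty (MinSpec H ≃ₜ RightOrders E) := by
  obtain ⟨φ⟩ := nonempty_minSpec_homeomorph (𝒪 := Set.univ) hE (fun C _ => hext C)
    fun P hP hne => by
      obtain ⟨C, -, hC⟩ := hP.exists_rightOrders_le_comap conjRepresentable_bot hne hE
      exact ⟨C, trivial, hC⟩
  exact ⟨φ.trans (Homeomorph.Set.univ _)⟩

theorem nonempty_minSpec_homeomorph_orders (hE : latticeClosure (E : Set H) = Set.univ)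
    (hH : ConjRepresentable (⊤ : Subgroup H))
    (hext : ∀ C : Orders E, ∃ P : Submonoid H, IsPrimeCone P ∧ P.comap E.subtype = C.1.1) :
    Nonempty (MinSpec H ≃ₜ Orders E) :=
  nonempty_minSpec_homeomorph (𝒪 := {C | ∀ a ∈ C.1, ∀ g : E, g * a * g⁻¹ ∈ C.1}) hE
    (fun C hC => hext ⟨C, hC⟩) fun P hP hne => by
      obtain ⟨C, hinv, hC⟩ := hP.exists_rightOrders_le_comap hH hne hE
      exact ⟨C, fun a ha g => hinv g trivial a ha, hC⟩

end Homeomorphism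

section ChainAutomorphisms

variable {Ω : Type*} [LinearOrder Ω]

/-- The pointwise order on the automorphisms of a chain, which makes them an ℓ-group. -/
instance : PartialOrder (Ω ≃o Ω) :=
  PartialOrder.lift (fun f : Ω ≃o Ω => (f : Ω → Ω)) DFunLike.coe_injective

/-- The pointwise maximum of two automorphisms of a chain. -/
def orderIsoSup (f g : Ω ≃o Ω) : Ω ≃o Ω :=
  StrictMono.orderIsoOfRightInverse (fun x => f x ⊔ g x)
    (fun _ _ h => max_lt_max (f.strictMono h) (g.strictMono h))
    (fun x => f.symm x ⊓ g.symm x) (fun x => by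
      rcases le_total (f.symm x) (g.symm x) with h | h
      · simpa [inf_eq_left.2 h] using g.le_symm_apply.1 h
      · simpa [inf_eq_right.2 h] using f.le_symm_apply.1 h)

/-- The pointwise minimum of two automorphisms of a chain. -/
def orderIsoInf (f g : Ω ≃o Ω) : Ω ≃o Ω :=
  StrictMono.orderIsoOfRightInverse (fun x => f x ⊓ g x)
    (fun _ _ h => min_lt_min (f.strictMono h) (g.strictMono h))
    (fun x => f.symm x ⊔ g.symm x) (fun x => by
      rcases le_total (f.symm x) (g.symm x) with h | h
      · simpa [sup_eq_right.2 h] using f.symm_apply_le.1 h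
      · simpa [sup_eq_left.2 h] using g.symm_apply_le.1 h)

instance : Lattice (Ω ≃o Ω) where
  sup := orderIsoSup
  le_sup_left f g := fun x => le_max_left (f x) (g x)
  le_sup_right f g := fun x => le_max_right (f x) (g x)
  sup_le _ _ _ hf hg := fun x => max_le (hf x) (hg x)
  inf := orderIsoInf
  inf_le_left f g := fun x => min_le_left (f x) (g x)
  inf_le_right f g := fun x => min_le_right (f x) (g x)
  le_inf _ _ _ hf hg := fun x => le_min (hf x) (hg x)

instance : MulLeftMono (Ω ≃o Ω) := ⟨fun h _ _ hfg x => h.monotone (hfg x)⟩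

instance : MulRightMono (Ω ≃o Ω) := ⟨fun h _ _ hfg x => hfg (h x)⟩

/-- The positive cone of the stabilizer of the point `ω`: the automorphisms of a chain that do not
move `ω` down. -/
def pointCone (ω : Ω) : Submonoid (Ω ≃o Ω) where
  carrier := {f | ω ≤ f ω}
  one_mem' := le_rfl
  mul_mem' {f _} hf hg := hf.trans (f.monotone hg)

theorem mem_pointCone {ω : Ω} {f : Ω ≃o Ω} : f ∈ pointCone ω ↔ ω ≤ f ω := Iff.rfl

theorem isPrimeCone_pointCone (ω : Ω) : IsPrimeCone (pointCone ω) where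
  of_one_le _ hf := hf ω
  inf_mem _ hf _ hg := le_inf (α := Ω) hf hg
  isMulSpanning f := (le_total ω (f ω)).imp_right f.le_symm_apply.2

end ChainAutomorphisms

section OrderedChain

variable {E : Type*} [Group E] [PartialOrder E]

/-- A group with the left-invariant total order `a ≤ b` iff `a⁻¹ * b ∈ C`, for a right order with
positive cone `C`. It is the opposite-sided companion of the right order, so that left translations
are order automorphisms. -/
def RightOrders.Chain (_ : RightOrders E) : Type _ := E

namespace RightOrders

variable (C : RightOrders E)

instance : Group C.Chain := inferInstanceAs (Group E)

/-- The identity map from a group to the chain of a right order. -/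
def toChain : E ≃* C.Chain := MulEquiv.refl E

noncomputable instance : LinearOrder C.Chain where
  le a b := C.toChain.symm (a⁻¹ * b) ∈ C.1
  le_refl a := by simp [C.1.one_mem]
  le_trans a b c h1 h2 := by simpa [mul_assoc] using C.1.mul_mem h1 h2
  le_antisymm a b h1 h2 := by
    have h := C.2.antisymm _ h1 (by simpa using h2)
    rw [map_eq_one_iff C.toChain.symm C.toChain.symm.injective, inv_mul_eq_one] at h
    exact h
  le_total a b := by simpa using C.2.total (C.toChain.symm (a⁻¹ * b))
  toDecidableLE := Classical.decRel _

theorem toChain_le_toChain {a b : E} : C.toChain a ≤ C.toChain b ↔ a⁻¹ * b ∈ C.1 := Iff.rfl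

theorem one_le_toChain {a : E} : 1 ≤ C.toChain a ↔ a ∈ C.1 := by
  rw [← map_one C.toChain, toChain_le_toChain, inv_one, one_mul]

instance : MulLeftMono C.Chain := ⟨fun c a b h => by
  change C.toChain.symm ((c * a)⁻¹ * (c * b)) ∈ C.1
  simpa [mul_assoc] using (show C.toChain.symm (a⁻¹ * b) ∈ C.1 from h)⟩

theorem toChain_monotone [MulLeftMono E] : Monotone C.toChain := fun a b h =>
  C.toChain_le_toChain.2 (C.2.of_one_le _ (by simpa using h))

/-- The action of a right-ordered group on its chain by left translations. -/
noncomputable def mulLeftHom : E →* (C.Chain ≃o C.Chain) where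
  toFun e := OrderIso.mulLeft (C.toChain e)
  map_one' := by ext x; simp
  map_mul' a b := by ext x; simp [mul_assoc]

theorem mulLeftHom_apply (e : E) (x : C.Chain) : C.mulLeftHom e x = C.toChain e * x := rfl

theorem mulLeftHom_monotone [MulLeftMono E] [MulRightMono E] : Monotone C.mulLeftHom :=
  fun a b h x => by
    obtain ⟨x, rfl⟩ := C.toChain.surjective x
    change C.toChain a * C.toChain x ≤ C.toChain b * C.toChain x
    rw [← map_mul, ← map_mul]
    exact C.toChain_monotone (mul_le_mul_left h x)

theorem comap_mulLeftHom_pointCone_one : (pointCone (1 : C.Chain)).comap C.mulLeftHom = C.1 := by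
  ext e
  rw [Submonoid.mem_comap, mem_pointCone, mulLeftHom_apply, mul_one, one_le_toChain]

end RightOrders

instance Orders.mulRightMono_chain (C : Orders E) : MulRightMono C.1.Chain := ⟨fun c a b h => by
  change C.1.toChain.symm ((a * c)⁻¹ * (b * c)) ∈ C.1.1
  simpa [mul_assoc] using C.2 _ h (C.1.toChain.symm c)⁻¹⟩

end OrderedChain

section FreeLGroup

universe u

instance subgroupMulLeftMono {H : Type*} [Group H] [PartialOrder H] [MulLeftMono H]
    (E : Subgroup H) : MulLeftMono E := ⟨fun c _ _ h => mul_le_mul_right (α := H) h c⟩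

instance subgroupMulRightMono {H : Type*} [Group H] [PartialOrder H] [MulRightMono H]
    (E : Subgroup H) : MulRightMono E := ⟨fun c _ _ h => mul_le_mul_left (α := H) h c⟩

theorem IsLHom.monotone {H A : Type*} [Group H] [Lattice H] [Group A] [Lattice A] {f : H →* A}
    (hf : IsLHom f) : Monotone f := fun a b h => by
  rw [← sup_eq_right, ← hf.map_sup, sup_eq_right.2 h]

theorem IsLHom.isPrimeCone_comap {H A : Type*} [Group H] [Lattice H] [Group A] [Lattice A]
    {f : H →* A} (hf : IsLHom f) {P : Submonoid A} (hP : IsPrimeCone P) :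
    IsPrimeCone (P.comap f) where
  of_one_le a ha := hP.of_one_le _ (by simpa using hf.monotone ha)
  inf_mem a ha b hb := by
    rw [Submonoid.mem_comap, hf.map_inf]
    exact hP.inf_mem _ ha _ hb
  isMulSpanning a := by simpa using hP.isMulSpanning (f a)

theorem isPrimeCone_oneLE {T : Type*} [Group T] [LinearOrder T] [MulLeftMono T] :
    IsPrimeCone (Submonoid.oneLE T) where
  toIsLatticeCone := isLatticeCone_oneLE
  isMulSpanning a := (le_total 1 a).imp_right Left.one_le_inv_iff.2

theorem representableLGroups_of_linearOrder (T : Type u) [Group T] [LinearOrder T] [MulLeftMono T]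
    [MulRightMono T] : RepresentableLGroups T :=
  ⟨PUnit, fun _ => T, fun _ => inferInstance, fun _ => inferInstance, fun _ => inferInstance,
    fun _ => inferInstance, fun _ => MonoidHom.id T,
    fun _ => ⟨⟨fun _ _ => rfl, fun _ _ => rfl⟩, Function.surjective_id⟩, fun _ _ h => h ⟨⟩⟩

variable {V : LClass.{u}} {G : Type u} [Group G] [PartialOrder G]

theorem latticeClosure_range_eta :
    latticeClosure ((eta V G).range : Set (Free V G)) = Set.univ := by
  refine Set.eq_univ_of_forall fun x => ?_
  have hsub := isSublattice_latticeClosure (s := ((eta V G).range : Set (Free V G)))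
  induction x using Free.ind with
  | h t =>
    induction t with
    | of g => exact subset_latticeClosure ⟨g, rfl⟩
    | one => exact subset_latticeClosure (one_mem (eta V G).range)
    | mul s t hs ht => exact mul_mem_latticeClosure hs ht
    | inv s hs => exact inv_mem_latticeClosure hs
    | sup s t hs ht => exact hsub.supClosed hs ht
    | inf s t hs ht => exact hsub.infClosed hs ht

theorem Free.exists_isPrimeCone_comap_eq {A : Type u} [Group A] [Lattice A] [MulLeftMono A]
    [MulRightMono A] (hA : V A) {p : (eta V G).range →* A} (hp : Monotone p) {P : Submonoid A}
    (hP : IsPrimeCone P) :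
    ∃ Q : Submonoid (Free V G), IsPrimeCone Q ∧ Q.comap (eta V G).range.subtype = P.comap p := by
  have hmono : Monotone (p.comp (eta V G).rangeRestrict) := fun a b h => hp (eta_monotone V G h)
  refine ⟨P.comap (Free.lift hA _ hmono), (Free.isLHom_lift hA _ hmono).isPrimeCone_comap hP, ?_⟩
  ext ⟨_, g, rfl⟩
  rfl

theorem nonempty_minSpec_free_homeomorph_orders
    (hfree : ConjRepresentable (⊤ : Subgroup (Free V G)))
    (hV : ∀ C : Orders (eta V G).range, V C.1.Chain) :
    Nonempty (MinSpec (Free V G) ≃ₜ Orders (eta V G).range) :=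
  nonempty_minSpec_homeomorph_orders latticeClosure_range_eta hfree fun C => by
    obtain ⟨P, hP, hPC⟩ := Free.exists_isPrimeCone_comap_eq (hV C)
      (p := C.1.toChain.toMonoidHom) C.1.toChain_monotone isPrimeCone_oneLE
    exact ⟨P, hP, hPC.trans (Submonoid.ext fun _ => C.1.one_le_toChain)⟩

end FreeLGroup

end LatticeGroup

theorem corollary5p11_general (G : Type*) [Group G] [PartialOrder G] :
    Nonempty (MinSpec (Free AllLGroups G) ≃ₜ RightOrders (eta AllLGroups G).range) ∧
    Nonempty (MinSpec (Free RepresentableLGroups G) ≃ₜ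
      Orders (eta RepresentableLGroups G).range) ∧
    Nonempty (MinSpec (Free AbelianLGroups G) ≃ₜ Orders (eta AbelianLGroups G).range) := by
  refine ⟨?all, ?representable, ?abelian⟩
  case all =>
    refine nonempty_minSpec_homeomorph_rightOrders latticeClosure_range_eta fun C => ?_
    rw [← C.comap_mulLeftHom_pointCone_one]
    exact Free.exists_isPrimeCone_comap_eq trivial C.mulLeftHom_monotone (isPrimeCone_pointCone 1)
  case representable =>
    exact nonempty_minSpec_free_homeomorph_orders
      ((representableLGroups_free G).conjRepresentable ⊤)
      fun C => representableLGroups_of_linearOrder C.1.Chain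
  case abelian =>
    have hcomm := abelianLGroups_free G
    exact nonempty_minSpec_free_homeomorph_orders (hcomm.conjRepresentable ⊤)
      fun C a b => C.1.toChain.symm.injective (Subtype.ext (by simpa using hcomm _ _))

theorem corollary5p11 (G : Type*) [Group G] [PartialOrder G] [MulLeftMono G] [MulRightMono G] :
    Nonempty (MinSpec (Free AllLGroups G) ≃ₜ RightOrders (eta AllLGroups G).range) ∧
    Nonempty (MinSpec (Free RepresentableLGroups G) ≃ₜ
      Orders (eta RepresentableLGroups G).range) ∧
    Nonempty (MinSpec (Free AbelianLGroups G) ≃ₜ Orders (eta AbelianLGroups G).range) :=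
  corollary5p11_general G
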